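/- Let $L$ be a finite first-order language, $K$ any class of $L$-structures (for instance the class of all $L$-structures, of all groups, or of all projective planes), and let $A\in K$ be a quasi-Hopfian structure that is finitely presented in $K$, generated by $(a_1,\dots,a_n)$. Here: - $A$ is *finitely presented in $K$* if it has a finite generating tuple $\bar p$ and there is a finite set $\Phi(\bar x)$ of atomic formulas true of $\bar p$ in $A$ such that, for every $B\in K$ and every tuple $\bar b$ of $B$ with $B\models\Phi(\bar b)$, there is a homomorphism $A\to B$ with $\bar p\mapsto\bar b$; - $A$ is *quasi-Hopfian* if it has a finite generating set $S_0$ such that every surjective homomorphism $A\to A$ which is injective on $S_0$ is an automorphism of $A$; - in $\mathfrak L_{\omega_1,\omega}$, the $\Sigma_0$ and $\Pi_0$ formulas (also in the computable sense) are the finitary quantifier-free ones; for $k>0$, a (computable) $\Sigma_k$ formula is a countable (computably enumerable) disjunction of formulas $\exists\bar y\,\psi$ with $\psi$ (computable) $\Pi_j$, $j<k$; a (computable) $\Pi_k$ formula is a countable (computably enumerable) conjunction of formulas $\forall\bar y\,\psi$ with $\psi$ (computable) $\Sigma_j$, $j<k$; and a (computable) $d$-$\Sigma_k$ formula is a conjunction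 of a (computable) $\Sigma_k$ formula and a (computable) $\Pi_k$ formula; - a *Scott sentence* of $A$ is an $\mathfrak L_{\omega_1,\omega}$-sentence whose countable models are exactly the countable structures isomorphic to $A$. Then the $\mathrm{Aut}(A)$-orbit of $(a_1,\dots,a_n)$ is defined in $A$ by a $\Pi_1$ formula (without parameters), and $A$ has a $d$-$\Sigma_2$ Scott sentence. Suppose in addition that $A$ is computable (it is isomorphic to a structure whose universe is a computable set of natural numbers and whose functions and relations are computable) and that there are a finite set $X\subseteq\mathrm{Aut}(A)$ generating the group $\mathrm{Aut}(A)$ and a computable $F:\omega^n\to\omega$ such that $$lg_X(\alpha)\le F\bigl(lg_S(\alpha(a_1)),\dots,lg_S(\alpha(a_n))\bigr)\quad\text{for every }\alpha\in\mathrm{Aut}(A),$$ where $S=\{a_1,\dots,a_n\}$, $lg_X(\alpha)$ is the least length of a product of elements of $X$ and their inverses equal to $\alpha$, and $lg_S(x)$ is the least number of occurrences of variables and function symbols in a term $t$ with $t(a_1,\dots,a_n)=x$. Then the $\mathrm{Aut}(A)$-orbit of $(a_1,\dots,a_n)$ is defined in $A$ by a computable $\Pi_1$ formula, and $A$ has a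 computable $d$-$\Sigma_2$ Scott sentence. -/

import Mathlib

open FirstOrder

universe u v w

/-! ### The logic `L_{ω₁,ω}` -/

/-- Formulas of the infinitary logic `L_{ω₁,ω}` with free variables among `x₀, …, x_{n-1}`:
they are obtained from finitary first-order formulas by negation, conjunction, countable
conjunctions and disjunctions, and quantification over finite (possibly empty) blocks of
variables. In `all m φ` and `ex m φ` the last `m` of the `n + m` variables are quantified. -/
inductive InfFormula (L : FirstOrder.Language.{u, v}) : ℕ → Type (max u v)
  | ofFormula {n : ℕ} (φ : L.Formula (Fin n)) : InfFormula L n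
  | not {n : ℕ} (φ : InfFormula L n) : InfFormula L n
  | and {n : ℕ} (φ ψ : InfFormula L n) : InfFormula L n
  | iInf {n : ℕ} (φ : ℕ → InfFormula L n) : InfFormula L n
  | iSup {n : ℕ} (φ : ℕ → InfFormula L n) : InfFormula L n
  | all {n : ℕ} (m : ℕ) (φ : InfFormula L (n + m)) : InfFormula L n
  | ex {n : ℕ} (m : ℕ) (φ : InfFormula L (n + m)) : InfFormula L n

namespace InfFormula

variable {L : FirstOrder.Language.{u, v}}

/-- Truth of an infinitary formula in a structure at a tuple of elements. -/
def Realize {A : Type w} [L.Structure A] : {n : ℕ} → InfFormula L n → (Fin n → A) → Prop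
  | _, ofFormula φ, b => φ.Realize b
  | _, not φ, b => ¬ φ.Realize b
  | _, and φ ψ, b => φ.Realize b ∧ ψ.Realize b
  | _, iInf φ, b => ∀ i, (φ i).Realize b
  | _, iSup φ, b => ∃ i, (φ i).Realize b
  | _, all m φ, b => ∀ y : Fin m → A, φ.Realize (Fin.append b y)
  | _, ex m φ, b => ∃ y : Fin m → A, φ.Realize (Fin.append b y)

mutual

/-- `IsSigma k φ`: `φ` is a `Σ_k` formula (`k` finite). Finitary quantifier-free formulas are
`Σ_0`; for `k > 0`, a `Σ_k` formula is a countable disjunction of formulas `∃ȳ ψ` with `ψ` a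
`Π_j` formula for some `j < k`. -/
inductive IsSigma : ℕ → {n : ℕ} → InfFormula L n → Prop
  | zero {n : ℕ} {φ : L.Formula (Fin n)} (h : φ.IsQF) : IsSigma 0 (ofFormula φ)
  | disj {n k : ℕ} (m j : ℕ → ℕ) (ψ : ∀ i, InfFormula L (n + m i)) (hj : ∀ i, j i < k)
      (h : ∀ i, IsPi (j i) (ψ i)) : IsSigma k (iSup fun i => ex (m i) (ψ i))

/-- `IsPi k φ`: `φ` is a `Π_k` formula (`k` finite). Finitary quantifier-free formulas are
`Π_0`; for `k > 0`, a `Π_k` formula is a countable conjunction of formulas `∀ȳ ψ` with `ψ` a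
`Σ_j` formula for some `j < k`. -/
inductive IsPi : ℕ → {n : ℕ} → InfFormula L n → Prop
  | zero {n : ℕ} {φ : L.Formula (Fin n)} (h : φ.IsQF) : IsPi 0 (ofFormula φ)
  | conj {n k : ℕ} (m j : ℕ → ℕ) (ψ : ∀ i, InfFormula L (n + m i)) (hj : ∀ i, j i < k)
      (h : ∀ i, IsSigma (j i) (ψ i)) : IsPi k (iInf fun i => all (m i) (ψ i))

end

/-- A `d-Σ_k` formula is a conjunction of a `Σ_k` formula and a `Π_k` formula. -/
def IsDSigma (k : ℕ) {n : ℕ} (θ : InfFormula L n) : Prop :=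
  ∃ σ π : InfFormula L n, θ = and σ π ∧ σ.IsSigma k ∧ π.IsPi k

section Computable

variable [Encodable (Σ l, L.Functions l)] [Encodable (Σ l, L.Relations l)]

/-- The Gödel number of a finitary formula: the numerical code of Mathlib's representation of
the formula as a list of symbols (in Polish notation). -/
def formulaCode {n : ℕ} (φ : L.Formula (Fin n)) : ℕ :=
  Encodable.encode (FirstOrder.Language.BoundedFormula.listEncode φ)

mutual

/-- `IsSigmaIndex k φ e`: `φ` is a computable `Σ_k` formula with index `e`. For `k = 0` the
index of a quantifier-free formula is its Gödel number. For `k > 0`, `φ` is a computably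
enumerable disjunction of formulas `∃ȳ ψ`, where `ψ` is a computable `Π_j` formula, `j < k`: the
index of `φ` is the code of a program of a total computable function listing, for each
disjunct, the length of `ȳ`, the level `j` and an index of `ψ`. (Repetitions are allowed, and the
empty disjunction is represented by a list all of whose entries are `⊥`.) -/
inductive IsSigmaIndex : ℕ → {n : ℕ} → InfFormula L n → ℕ → Prop
  | zero {n : ℕ} {φ : L.Formula (Fin n)} (h : φ.IsQF) :
      IsSigmaIndex 0 (ofFormula φ) (formulaCode φ)
  | disj {n k : ℕ} (m j e : ℕ → ℕ) (ψ : ∀ i, InfFormula L (n + m i)) (c : Nat.Partrec.Code)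
      (hj : ∀ i, j i < k) (h : ∀ i, IsPiIndex (j i) (ψ i) (e i))
      (hc : ∀ i, c.eval i = Part.some (Nat.pair (m i) (Nat.pair (j i) (e i)))) :
      IsSigmaIndex k (iSup fun i => ex (m i) (ψ i)) (Encodable.encode c)

/-- `IsPiIndex k φ e`: `φ` is a computable `Π_k` formula with index `e`; as for `IsSigmaIndex`,
with computably enumerable conjunctions of formulas `∀ȳ ψ`, where `ψ` is a computable `Σ_j`
formula, `j < k`. -/
inductive IsPiIndex : ℕ → {n : ℕ} → InfFormula L n → ℕ → Prop
  | zero {n : ℕ} {φ : L.Formula (Fin n)} (h : φ.IsQF) :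
      IsPiIndex 0 (ofFormula φ) (formulaCode φ)
  | conj {n k : ℕ} (m j e : ℕ → ℕ) (ψ : ∀ i, InfFormula L (n + m i)) (c : Nat.Partrec.Code)
      (hj : ∀ i, j i < k) (h : ∀ i, IsSigmaIndex (j i) (ψ i) (e i))
      (hc : ∀ i, c.eval i = Part.some (Nat.pair (m i) (Nat.pair (j i) (e i)))) :
      IsPiIndex k (iInf fun i => all (m i) (ψ i)) (Encodable.encode c)

end

/-- `φ` is a computable `Σ_k` formula. -/
def IsComputableSigma (k : ℕ) {n : ℕ} (φ : InfFormula L n) : Prop := ∃ e, φ.IsSigmaIndex k e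

/-- `φ` is a computable `Π_k` formula. -/
def IsComputablePi (k : ℕ) {n : ℕ} (φ : InfFormula L n) : Prop := ∃ e, φ.IsPiIndex k e

/-- A computable `d-Σ_k` formula is a conjunction of a computable `Σ_k` formula and a computable
`Π_k` formula. -/
def IsComputableDSigma (k : ℕ) {n : ℕ} (θ : InfFormula L n) : Prop :=
  ∃ σ π : InfFormula L n, θ = and σ π ∧ σ.IsComputableSigma k ∧ π.IsComputablePi k

end Computable

/-- `φ(x₀, …, x_{n-1})` defines the set `D` of `n`-tuples of the structure `A`. -/
def Defines {A : Type w} [L.Structure A] {n : ℕ} (φ : InfFormula L n) (D : Set (Fin n → A)) :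
    Prop :=
  ∀ b : Fin n → A, φ.Realize b ↔ b ∈ D

/-- The sentence `Θ` is a Scott sentence of `A`: its countable models are exactly the countable
structures isomorphic to `A`. -/
def IsScottSentence (Θ : InfFormula L 0) (A : Type w) [L.Structure A] : Prop :=
  ∀ (B : Type w) [L.Structure B] [Countable B],
    Θ.Realize (Fin.elim0 : Fin 0 → B) ↔ Nonempty (A ≃[L] B)

end InfFormula

/-! ### Finitely presented and quasi-Hopfian structures, automorphisms -/

namespace FinPres

/-- `A` is finitely presented in the class `K` of `L`-structures: `A` belongs to `K` and there are
a finite generating tuple `p` of `A` and a finite set `Φ` of atomic formulas true of `p` in `A`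
such that every tuple `b` of a structure `B` in `K` at which all formulas of `Φ` are true is the
image of `p` under a homomorphism `A → B` (which is unique, since `p` generates `A`). -/
def FinitelyPresented (L : FirstOrder.Language.{u, v})
    (K : Set (CategoryTheory.Bundled.{w} L.Structure)) (A : Type w) [L.Structure A] : Prop :=
  (⟨A, inferInstance⟩ : CategoryTheory.Bundled.{w} L.Structure) ∈ K ∧
  ∃ (m : ℕ) (p : Fin m → A) (Φ : Set (L.Formula (Fin m))),
    FirstOrder.Language.Substructure.closure L (Set.range p) = ⊤ ∧
    Φ.Finite ∧ (∀ φ ∈ Φ, φ.IsAtomic ∧ φ.Realize p) ∧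
    ∀ B : CategoryTheory.Bundled.{w} L.Structure, B ∈ K → ∀ b : Fin m → B,
      (∀ φ ∈ Φ, φ.Realize b) → ∃ f : A →[L] B, ∀ i, f (p i) = b i

/-- `A` is quasi-Hopfian: it has a finite generating set `S` such that every surjective
endomorphism of `A` which is injective on `S` is an automorphism. -/
def QuasiHopfian (L : FirstOrder.Language.{u, v}) (A : Type w) [L.Structure A] : Prop :=
  ∃ S : Set A, S.Finite ∧ FirstOrder.Language.Substructure.closure L S = ⊤ ∧
    ∀ f : A →[L] A, Function.Surjective f → Set.InjOn f S → ∃ e : A ≃[L] A, e.toHom = f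

/-- The automorphism group of `A`, with composition as multiplication. -/
instance autGroup (L : FirstOrder.Language.{u, v}) (A : Type w) [L.Structure A] :
    Group (A ≃[L] A) where
  mul α β := α.comp β
  one := FirstOrder.Language.Equiv.refl L A
  inv α := α.symm
  mul_assoc _ _ _ := rfl
  one_mul _ := rfl
  mul_one _ := rfl
  inv_mul_cancel α := FirstOrder.Language.Equiv.ext fun x => α.symm_apply_apply x

/-- The `Aut(A)`-orbit of a tuple. -/
def autOrbit (L : FirstOrder.Language.{u, v}) {A : Type w} [L.Structure A] {n : ℕ}
    (a : Fin n → A) : Set (Fin n → A) :=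
  {b | ∃ α : A ≃[L] A, ∀ i, b i = α (a i)}

/-- The length of an element of a group `G` with respect to a generating set `X`: the least
length of a product of elements of `X` and their inverses that represents it. -/
noncomputable def groupLength {G : Type w} [Group G] (X : Set G) (g : G) : ℕ :=
  sInf {k | ∃ l : List G, l.length = k ∧ (∀ x ∈ l, x ∈ X ∨ x⁻¹ ∈ X) ∧ l.prod = g}

/-- The length of a term: the number of occurrences in it of variables and function symbols. -/
def termLength {L : FirstOrder.Language.{u, v}} {n : ℕ} (t : L.Term (Fin n)) : ℕ :=
  t.listEncode.length

/-- The length of an element `x` of a structure generated by `a₀, …, a_{n-1}`: the least length of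
a term `t` with `t(a₀, …, a_{n-1}) = x`. -/
noncomputable def elemLength (L : FirstOrder.Language.{u, v}) {A : Type w} [L.Structure A] {n : ℕ}
    (a : Fin n → A) (x : A) : ℕ :=
  sInf {k | ∃ t : L.Term (Fin n), t.realize a = x ∧ termLength t = k}

/-- The structure `A` (in a finite language) is computable: its elements can be identified with
the elements of a computable set of natural numbers in such a way that every function and
every relation of `A` becomes computable. -/
def ComputableStructure (L : FirstOrder.Language.{u, v}) (A : Type w) [L.Structure A] : Prop :=
  ∃ ν : A → ℕ, Function.Injective ν ∧
    ComputablePred (fun k : ℕ => k ∈ Set.range ν) ∧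
    (∀ (l : ℕ) (f : L.Functions l), ∃ g : List ℕ → ℕ, Computable g ∧
      ∀ x : Fin l → A,
        g (List.ofFn fun i => ν (x i)) = ν (FirstOrder.Language.Structure.funMap f x)) ∧
    ∀ (l : ℕ) (R : L.Relations l), ComputablePred fun s : List ℕ =>
      ∃ x : Fin l → A, s = List.ofFn (fun i => ν (x i)) ∧ FirstOrder.Language.Structure.RelMap R x

end FinPres

namespace FinPres

open Encodable

/-! ### Computability of iterated operations and of bounded searches -/

theorem computable_getD_apply {α β : Type*} [Primcodable α] [Primcodable β]
    (l : List (α → β)) (d : α → β) (hl : ∀ f ∈ l, Computable f) (hd : Computable d) :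
    Computable₂ fun (k : ℕ) (x : α) => l.getD k d x := by
  induction l with
  | nil => exact hd.comp Computable.snd
  | cons f l ih =>
    have h : Computable fun p : ℕ × α =>
        (Nat.casesOn p.1 (f p.2) fun k => l.getD k d p.2 : β) :=
      Computable.nat_casesOn Computable.fst
        ((hl f List.mem_cons_self).comp Computable.snd)
        ((ih fun g hg => hl g (List.mem_cons_of_mem f hg)).comp Computable.snd
          (Computable.snd.comp Computable.fst))
    refine h.of_eq fun p => ?_
    rcases p with ⟨_ | k, x⟩ <;> rfl

/-- The enumeration of all the states that are reached from `init` by applying the operations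
`op x`, where `x` runs through the list `idx`. -/
def iterOps {ι σ : Type*} (idx : List ι) (op : ι → σ → σ) (init : σ) : ℕ → σ
  | 0 => init
  | k + 1 => (idx.map op).getD k.unpair.1 id (iterOps idx op init k.unpair.2)
  decreasing_by exact Nat.lt_succ_of_le (Nat.unpair_right_le k)

section IterOps

variable {ι σ τ : Type*} {idx : List ι} {op : ι → σ → σ} {init : σ}

theorem iterOps_zero : iterOps idx op init 0 = init := by rw [iterOps]

theorem iterOps_succ (k : ℕ) : iterOps idx op init (k + 1) =
    (idx.map op).getD k.unpair.1 id (iterOps idx op init k.unpair.2) := by rw [iterOps]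

theorem getD_map_apply_induction (P : σ → σ → Prop) (k : ℕ) (s : σ) (h0 : P s s)
    (h : ∀ x ∈ idx, P s (op x s)) : P s ((idx.map op).getD k id s) := by
  rcases lt_or_ge k idx.length with hk | hk
  · have : (idx.map op).getD k id = op idx[k] := by simp [hk]
    rw [this]
    exact h _ (List.getElem_mem hk)
  · have : (idx.map op).getD k id = id := by simp [hk]
    rwa [this]

theorem iterOps_induction (P : σ → Prop) (h0 : P init)
    (h : ∀ x ∈ idx, ∀ s, P s → P (op x s)) (k : ℕ) : P (iterOps idx op init k) := by
  induction k using Nat.strong_induction_on with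
  | _ k ih =>
    rcases k with _ | k
    · rwa [iterOps_zero]
    · rw [iterOps_succ]
      have hk := ih _ (Nat.lt_succ_of_le (Nat.unpair_right_le k))
      exact getD_map_apply_induction (fun _ s => P s) _ _ hk fun x hx => h x hx _ hk

theorem exists_iterOps_eq_op {x : ι} (hx : x ∈ idx) (j : ℕ) :
    ∃ j', iterOps idx op init j' = op x (iterOps idx op init j) ∧
      j' ≤ Nat.pair idx.length j + 1 := by
  obtain ⟨k, hk, rfl⟩ := List.getElem_of_mem hx
  refine ⟨Nat.pair k j + 1, ?_, Nat.succ_le_succ (Nat.pair_lt_pair_left j hk).le⟩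
  rw [iterOps_succ, Nat.unpair_pair]
  simp [hk]

theorem map_iterOps {op' : ι → τ → τ} (φ : σ → τ)
    (h : ∀ x ∈ idx, ∀ s, φ (op x s) = op' x (φ s)) (k : ℕ) :
    φ (iterOps idx op init k) = iterOps idx op' (φ init) k := by
  induction k using Nat.strong_induction_on with
  | _ k ih =>
    rcases k with _ | k
    · rw [iterOps_zero, iterOps_zero]
    · rw [iterOps_succ, iterOps_succ, ← ih _ (Nat.lt_succ_of_le (Nat.unpair_right_le k))]
      rcases lt_or_ge k.unpair.1 idx.length with hk | hk
      · simp [hk, h _ (List.getElem_mem hk)]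
      · simp [hk]

theorem computable_iterOps [Primcodable σ] (h : ∀ x ∈ idx, Computable (op x)) :
    Computable (iterOps idx op init) := by
  have hg : Computable₂ fun (_ : Unit) (l : List σ) => (Nat.casesOn l.length (some init)
      fun k => (l[k.unpair.2]?).map fun s => (idx.map op).getD k.unpair.1 id s : Option σ) := by
    refine Computable.nat_casesOn (Computable.list_length.comp Computable.snd)
      (Computable.const _) ?_
    have hu : Computable fun p : (Unit × List σ) × ℕ => p.2.unpair :=
      Computable.unpair.comp Computable.snd
    refine Computable.option_map (Computable.list_getElem?.comp
      (Computable.snd.comp Computable.fst) (Computable.snd.comp hu)) ?_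
    refine (computable_getD_apply _ _ ?_ Computable.id).comp
      ((Computable.fst.comp hu).comp Computable.fst) Computable.snd
    intro f hf
    obtain ⟨x, hx, rfl⟩ := List.mem_map.1 hf
    exact h x hx
  have := Computable.nat_strong_rec (fun (_ : Unit) => iterOps idx op init) hg fun _ k => by
    rcases k with _ | k
    · simp [iterOps_zero]
    · have hk : k.unpair.2 < k + 1 := Nat.lt_succ_of_le (Nat.unpair_right_le k)
      simp [iterOps_succ, hk]
  exact this.comp (Computable.const ()) Computable.id

end IterOps

theorem computable_decide_eq {α β : Type*} [Primcodable α] [Primcodable β] [DecidableEq β]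
    {f g : α → β} (hf : Computable f) (hg : Computable g) :
    Computable fun x => decide (f x = g x) :=
  (Primrec.eq (α := β)).decide.to_comp.comp hf hg

theorem computable_decide_le {α : Type*} [Primcodable α] {f g : α → ℕ}
    (hf : Computable f) (hg : Computable g) : Computable fun x => decide (f x ≤ g x) :=
  Primrec.nat_le.decide.to_comp.comp hf hg

theorem computable_ite {α β : Type*} [Primcodable α] [Primcodable β] {p : α → Prop}
    [DecidablePred p] {f g : α → β} (hp : Computable fun x => decide (p x)) (hf : Computable f)
    (hg : Computable g) : Computable fun x => if p x then f x else g x :=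
  (Computable.cond hp hf hg).of_eq fun x => by by_cases h : p x <;> simp [h]

theorem computable_decide_exists_le {α : Type*} [Primcodable α] [DecidableEq α] {f : ℕ → α}
    (hf : Computable f) : Computable₂ fun (m : ℕ) (x : α) => decide (∃ k ≤ m, f k = x) := by
  have h : Computable fun p : ℕ × α => (Nat.rec (decide (f 0 = p.2))
      (fun k b => b || decide (f (k + 1) = p.2)) p.1 : Bool) := by
    refine Computable.nat_rec (f := fun p : ℕ × α => p.1)
      (h := fun (p : ℕ × α) (q : ℕ × Bool) => q.2 || decide (f (q.1 + 1) = p.2)) Computable.fst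
      (computable_decide_eq (Computable.const _) Computable.snd) ?_
    have hor : Computable₂ or := Primrec.or.to_comp
    exact Computable.of_eq
      (f := fun q : (ℕ × α) × (ℕ × Bool) => q.2.2 || decide (f (q.2.1 + 1) = q.1.2))
      (hor.comp (Computable.snd.comp Computable.snd)
        (computable_decide_eq (hf.comp (Computable.succ.comp (Computable.fst.comp Computable.snd)))
          (Computable.snd.comp Computable.fst))) fun _ => rfl
  refine h.of_eq fun ⟨m, x⟩ => ?_
  induction m with
  | zero => simp
  | succ m ih =>
    change (_ || _) = _
    rw [show (Nat.rec (decide (f 0 = x)) (fun k b => b || decide (f (k + 1) = x)) m : Bool) =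
      decide (∃ k ≤ m, f k = x) from ih]
    rw [Bool.eq_iff_iff]
    simp only [Bool.or_eq_true, decide_eq_true_eq, Nat.le_succ_iff]
    constructor
    · rintro (⟨k, hk, h⟩ | h)
      exacts [⟨k, .inl hk, h⟩, ⟨_, .inr rfl, h⟩]
    · rintro ⟨k, hk | rfl, h⟩
      exacts [.inl ⟨k, hk, h⟩, .inr h]

/-- A bound for the codes of the lists of length `k` with entries at most `m`. -/
def listCodeBound (m : ℕ) : ℕ → ℕ
  | 0 => 0
  | k + 1 => Nat.pair m (listCodeBound m k) + 1

theorem pair_le_pair {a b c d : ℕ} (h : a ≤ c) (h' : b ≤ d) : Nat.pair a b ≤ Nat.pair c d :=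
  ((h.lt_or_eq.elim (fun h => (Nat.pair_lt_pair_left b h).le) fun h => h ▸ le_rfl)).trans
    (h'.lt_or_eq.elim (fun h => (Nat.pair_lt_pair_right c h).le) fun h => h ▸ le_rfl)

theorem encode_le_listCodeBound {m : ℕ} (l : List ℕ) (h : ∀ x ∈ l, x ≤ m) :
    encode l ≤ listCodeBound m l.length := by
  induction l with
  | nil => simp [listCodeBound]
  | cons x l ih =>
    rw [encode_list_cons, List.length_cons, listCodeBound]
    exact Nat.succ_le_succ (pair_le_pair (h x List.mem_cons_self)
      (ih fun y hy => h y (List.mem_cons_of_mem x hy)))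

theorem computable_listCodeBound (k : ℕ) : Computable fun m => listCodeBound m k := by
  induction k with
  | zero => exact Computable.const 0
  | succ k ih => exact Computable.succ.comp (Primrec₂.natPair.to_comp.comp Computable.id ih)

theorem exists_computable_bound {n : ℕ} {F : (Fin n → ℕ) → ℕ} (hF : Computable F) :
    ∃ G : ℕ → ℕ, Computable G ∧ ∀ (m : ℕ) (k : Fin n → ℕ), (∀ i, k i ≤ m) → F k ≤ G m := by
  let F' : ℕ → ℕ := fun c => F fun i => (Denumerable.ofNat (List ℕ) c).getD i 0
  have hF' : Computable F' := by
    refine hF.comp (Primrec.fin_curry.2 ?_).to_comp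
    exact (Primrec.list_getD 0).comp ((Primrec.ofNat (List ℕ)).comp Primrec.fst)
      (Primrec.fin_val.comp Primrec.snd)
  let S : ℕ → ℕ := fun b => Nat.rec (F' 0) (fun c s => s + F' (c + 1)) b
  have hadd : Computable₂ ((· + ·) : ℕ → ℕ → ℕ) := Primrec.nat_add.to_comp
  have hS : Computable S := by
    refine Computable.nat_rec (f := fun b : ℕ => b)
      (h := fun _ (q : ℕ × ℕ) => q.2 + F' (q.1 + 1)) Computable.id (Computable.const _) ?_
    exact Computable.of_eq (f := fun q : ℕ × (ℕ × ℕ) => q.2.2 + F' (q.2.1 + 1))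
      (hadd.comp (Computable.snd.comp Computable.snd)
        (hF'.comp (Computable.succ.comp (Computable.fst.comp Computable.snd)))) fun _ => rfl
  have hle : ∀ b c, c ≤ b → F' c ≤ S b := by
    intro b
    induction b with
    | zero => intro c hc; rw [Nat.le_zero.1 hc]; exact le_rfl
    | succ b ih =>
      intro c hc
      have hb : S (b + 1) = S b + F' (b + 1) := rfl
      rcases Nat.le_succ_iff.1 hc with hc | rfl
      · exact (ih c hc).trans (by omega)
      · exact hb ▸ Nat.le_add_left _ _
  refine ⟨fun m => S (listCodeBound m n), hS.comp (computable_listCodeBound n), ?_⟩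
  intro m k hk
  have h1 : F' (encode (List.ofFn k)) = F k := by
    simp [F']
  rw [← h1]
  refine hle _ _ ?_
  simpa using encode_le_listCodeBound (m := m) (List.ofFn k) (by simpa using hk)

end FinPres

namespace FinPres

open Encodable FirstOrder.Language

variable {L : FirstOrder.Language.{u, v}} {n : ℕ}

/-! ### An enumeration of the finite lists of terms -/

/-- The operation on lists of terms that a variable or a function symbol stands for: a variable
is put in front of the list, a function symbol is applied to the first entries of the list. -/
def stackOp : (Fin n ⊕ Σ l, L.Functions l) → List (L.Term (Fin n)) → List (L.Term (Fin n))
  | Sum.inl i, s => Term.var i :: s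
  | Sum.inr f, s =>
    if h : f.1 ≤ s.length then Term.func f.2 (fun i => s[i.1]) :: s.drop f.1 else s

section

variable [Finite (Σ l, L.Functions l)]

variable (L n) in
/-- A list of all variables and function symbols. -/
noncomputable def symbols : List (Fin n ⊕ Σ l, L.Functions l) :=
  (Set.toFinite (Set.univ : Set (Fin n ⊕ Σ l, L.Functions l))).toFinset.toList

theorem mem_symbols (s : Fin n ⊕ Σ l, L.Functions l) : s ∈ symbols L n := by
  simp [symbols]

variable (L n) in
/-- An enumeration of the finite lists of terms in `n` variables. -/
noncomputable def termStacks : ℕ → List (L.Term (Fin n)) :=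
  iterOps (symbols L n) stackOp []

theorem exists_termStacks_append (l : List (L.Term (Fin n)))
    (h : ∀ t ∈ l, ∀ j, ∃ j', termStacks L n j' = t :: termStacks L n j) (j : ℕ) :
    ∃ j', termStacks L n j' = l ++ termStacks L n j := by
  induction l with
  | nil => exact ⟨j, rfl⟩
  | cons t l ih =>
    obtain ⟨j', hj'⟩ := ih fun t ht => h t (List.mem_cons_of_mem _ ht)
    obtain ⟨k, hk⟩ := h t List.mem_cons_self j'
    exact ⟨k, by rw [hk, hj', List.cons_append]⟩

theorem exists_termStacks_cons (t : L.Term (Fin n)) :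
    ∀ j, ∃ j', termStacks L n j' = t :: termStacks L n j := by
  induction t with
  | var i =>
    intro j
    obtain ⟨j', hj', -⟩ := exists_iterOps_eq_op (op := stackOp) (init := [])
      (mem_symbols (L := L) (Sum.inl i)) j
    exact ⟨j', hj'⟩
  | @func l f ts ih =>
    intro j
    obtain ⟨k, hk⟩ := exists_termStacks_append (List.ofFn ts)
      (by simpa [List.mem_ofFn] using ih) j
    obtain ⟨j', hj', -⟩ := exists_iterOps_eq_op (op := stackOp) (init := [])
      (mem_symbols (L := L) (n := n) (Sum.inr ⟨l, f⟩)) k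
    refine ⟨j', hj'.trans ?_⟩
    change stackOp _ (termStacks L n k) = _
    rw [hk, stackOp]
    simp

theorem exists_termStacks_eq (l : List (L.Term (Fin n))) : ∃ j, termStacks L n j = l := by
  obtain ⟨j, hj⟩ := exists_termStacks_append l (fun t _ => exists_termStacks_cons t) 0
  exact ⟨j, by rw [hj, termStacks, iterOps_zero, List.append_nil]⟩

/-- A function of terms that is computable by recursion on terms is computable along the
enumeration of the finite lists of terms. -/
theorem computable_map_termStacks {γ : Type*} [Primcodable γ] (h : L.Term (Fin n) → γ)
    (hf : ∀ (l : ℕ) (f : L.Functions l), ∃ G : List γ → γ, Computable G ∧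
      ∀ ts : Fin l → L.Term (Fin n), h (Term.func f ts) = G (List.ofFn fun i => h (ts i))) :
    Computable fun j => (termStacks L n j).map h := by
  choose G hG hGh using hf
  let op : (Fin n ⊕ Σ l, L.Functions l) → List γ → List γ := fun x s => match x with
    | Sum.inl i => h (Term.var i) :: s
    | Sum.inr f => if f.1 ≤ s.length then G f.1 f.2 (s.take f.1) :: s.drop f.1 else s
  have hop : ∀ x, Computable (op x) := by
    rintro (i | f)
    · exact Computable.list_cons.comp (Computable.const _) Computable.id
    · refine computable_ite
        (computable_decide_le (Computable.const _) Computable.list_length) ?_ Computable.id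
      exact Computable.list_cons.comp
        ((hG f.1 f.2).comp ((Primrec.list_take.comp (Primrec.const _) Primrec.id).to_comp))
        ((Primrec.list_drop.comp (Primrec.const _) Primrec.id).to_comp)
  refine (computable_iterOps (idx := symbols L n) (init := []) fun x _ => hop x).of_eq fun j => ?_
  refine (map_iterOps (op := stackOp) (init := []) (List.map h) ?_ j).symm
  rintro (i | f) - s
  · simp [stackOp, op]
  · by_cases hl : f.1 ≤ s.length
    · have : (List.ofFn fun i : Fin f.1 => h s[i.1]) = (s.map h).take f.1 := by
        apply List.ext_getElem <;> simp [hl]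
      simp [stackOp, op, hl, hGh, this]
    · simp [stackOp, op, hl]

theorem computable_map_listEncode (sc : (Fin n ⊕ Σ l, L.Functions l) → ℕ) :
    Computable fun j => (termStacks L n j).map fun t => t.listEncode.map sc := by
  refine computable_map_termStacks _ fun l f => ⟨fun s => sc (Sum.inr ⟨l, f⟩) :: s.flatten,
    Computable.list_cons.comp (Computable.const _) Primrec.list_flatten.to_comp, fun ts => ?_⟩
  rw [Term.listEncode]
  simp [List.flatMap, List.ofFn_eq_map, Function.comp_def]

end

/-! ### Computing in a computable structure -/

variable {A : Type w} [L.Structure A]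

theorem exists_term_realize_eq {a : Fin n → A}
    (ha : Substructure.closure L (Set.range a) = ⊤) (x : A) :
    ∃ t : L.Term (Fin n), t.realize a = x := by
  have hx : x ∈ Substructure.closure L (Set.range a) := ha ▸ Substructure.mem_top x
  obtain ⟨t, rfl⟩ := Substructure.mem_closure_iff_exists_term.1 hx
  refine ⟨t.relabel fun y => y.2.choose, ?_⟩
  rw [Term.realize_relabel]
  congr 1
  funext y
  exact y.2.choose_spec

/-- The functions of `A` are computable with respect to the numbering `ν`. -/
def ComputableFunctions (L : FirstOrder.Language.{u, v}) {A : Type w} [L.Structure A]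
    (ν : A → ℕ) : Prop :=
  ∀ (l : ℕ) (f : L.Functions l), ∃ g : List ℕ → ℕ, Computable g ∧
    ∀ x : Fin l → A, g (List.ofFn fun i => ν (x i)) = ν (Structure.funMap f x)

theorem computable_map_realize [Finite (Σ l, L.Functions l)] {ν : A → ℕ}
    (hν : ComputableFunctions L ν) (a : Fin n → A) :
    Computable fun j => (termStacks L n j).map fun t => ν (t.realize a) := by
  refine computable_map_termStacks _ fun l f => ?_
  obtain ⟨g, hg, h⟩ := hν l f
  exact ⟨g, hg, fun ts => (h _).symm⟩

theorem exists_computable_realize {ν : A → ℕ} (hν : ComputableFunctions L ν)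
    (t : L.Term (Fin n)) : ∃ e : List ℕ → ℕ, Computable e ∧
      ∀ c : Fin n → A, e (List.ofFn fun i => ν (c i)) = ν (t.realize c) := by
  induction t with
  | var i =>
    refine ⟨fun l => l.getD i 0,
      ((Primrec.list_getD 0).comp Primrec.id (Primrec.const _)).to_comp, fun c => ?_⟩
    simp
  | @func l f ts ih =>
    choose e he h using ih
    obtain ⟨g, hg, hgf⟩ := hν l f
    refine ⟨fun s => g (List.ofFn fun i => e i s), hg.comp (Computable.list_ofFn he), fun c => ?_⟩
    simp only [h, hgf, Term.realize_func]

theorem elemLength_realize_le (a : Fin n → A) (t : L.Term (Fin n)) :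
    elemLength L a (t.realize a) ≤ termLength t :=
  Nat.sInf_le ⟨t, rfl, rfl⟩

theorem exists_list_prod_eq {G : Type*} [Group G] {X : Set G} (hX : Subgroup.closure X = ⊤)
    (g : G) : ∃ l : List G, l.length = groupLength X g ∧ (∀ x ∈ l, x ∈ X ∨ x⁻¹ ∈ X) ∧
      l.prod = g := by
  have hne : {k | ∃ l : List G, l.length = k ∧ (∀ x ∈ l, x ∈ X ∨ x⁻¹ ∈ X) ∧
      l.prod = g}.Nonempty := by
    have hg : g ∈ (Subgroup.closure X).toSubmonoid := by simp [hX]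
    rw [Subgroup.closure_toSubmonoid] at hg
    obtain ⟨l, hl, hg⟩ := Submonoid.exists_list_of_mem_closure hg
    exact ⟨_, l, rfl, hl, hg⟩
  exact Nat.sInf_mem hne

/-- A bound for the indices in an enumeration by `iterOps` with `c` operations of the states that
are reached in `k` steps. -/
def stepBound (c : ℕ) : ℕ → ℕ
  | 0 => 0
  | k + 1 => Nat.pair c (stepBound c k) + 1

theorem computable_stepBound (c : ℕ) : Computable (stepBound c) := by
  have h : Computable fun k : ℕ => (Nat.rec 0 (fun _ s => Nat.pair c s + 1) k : ℕ) := by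
    refine Computable.nat_rec (f := fun k : ℕ => k) (h := fun _ (q : ℕ × ℕ) => Nat.pair c q.2 + 1)
      Computable.id (Computable.const 0) ?_
    exact Computable.succ.comp (Primrec₂.natPair.to_comp.comp (Computable.const c)
      (Computable.snd.comp Computable.snd))
  refine h.of_eq fun k => ?_
  induction k with
  | zero => rfl
  | succ k ih => simp only [stepBound, ← ih]

theorem stepBound_mono (c : ℕ) : Monotone (stepBound c) :=
  monotone_nat_of_le_succ fun _ => (Nat.right_le_pair c _).trans (Nat.le_succ _)

theorem coe_mul (α β : A ≃[L] A) (x : A) : (α * β) x = α (β x) := rfl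

/-- If the automorphism group of a computable structure is generated by a finite set and lengths
of automorphisms are computably bounded in terms of the lengths of the images of the generators,
then membership in the orbit of the generators is decidable. -/
theorem exists_computable_mem_autOrbit {ν : A → ℕ} (hinj : Function.Injective ν)
    (hν : ComputableFunctions L ν) {a : Fin n → A}
    (ha : Substructure.closure L (Set.range a) = ⊤) {X : Set (A ≃[L] A)}
    {F : (Fin n → ℕ) → ℕ} (hX : X.Finite) (hXc : Subgroup.closure X = ⊤) (hF : Computable F)
    (hbound : ∀ α : A ≃[L] A, groupLength X α ≤ F fun i => elemLength L a (α (a i))) :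
    ∃ D : ℕ × List ℕ → Bool, Computable D ∧
      ∀ (r : Fin n → L.Term (Fin n)) (m : ℕ), (∀ i, termLength (r i) ≤ m) →
        (D (m, List.ofFn fun i => ν ((r i).realize a)) = true ↔
          (fun i => (r i).realize a) ∈ autOrbit L a) := by
  classical
  obtain ⟨G, hG, hGF⟩ := exists_computable_bound hF
  let Y : Set (A ≃[L] A) := {x | x ∈ X ∨ x⁻¹ ∈ X}
  have hY : Y.Finite := hX.union (hX.inv)
  let idx : List (A ≃[L] A) := hY.toFinset.toList
  have hidx : ∀ x, x ∈ idx ↔ x ∈ X ∨ x⁻¹ ∈ X := fun x => by simp [idx, Y]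
  choose T hT using exists_term_realize_eq (L := L) ha
  choose e he hev using exists_computable_realize (L := L) (n := n) hν
  let op : (A ≃[L] A) → List ℕ → List ℕ := fun x s => List.ofFn fun i => e (T (x (a i))) s
  let code : (A ≃[L] A) → List ℕ := fun β => List.ofFn fun i => ν (β (a i))
  let W : ℕ → List ℕ := iterOps idx op (code 1)
  have hop : ∀ x β, op x (code β) = code (β * x) := by
    intro x β
    simp only [op, code, hev, coe_mul]
    congr 1
    funext i
    conv_rhs => rw [← hT (x (a i)), ← HomClass.realize_term]
    rfl
  have hW : Computable W := computable_iterOps fun x _ => Computable.list_ofFn fun i => he _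
  have hsound : ∀ k, ∃ β, W k = code β := by
    refine iterOps_induction (fun s => ∃ β, s = code β) ⟨1, rfl⟩ ?_
    rintro x - s ⟨β, rfl⟩
    exact ⟨β * x, hop x β⟩
  have hcomplete : ∀ (l : List (A ≃[L] A)), (∀ x ∈ l, x ∈ X ∨ x⁻¹ ∈ X) → ∀ k β j,
      j ≤ stepBound idx.length k → W j = code β →
      ∃ j' ≤ stepBound idx.length (k + l.length), W j' = code (β * l.prod) := by
    intro l
    induction l with
    | nil => intro _ k β j hj h; exact ⟨j, hj, by simpa using h⟩
    | cons x l ih =>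
      intro hl k β j hj h
      obtain ⟨j', h', hj'⟩ := exists_iterOps_eq_op (op := op) (init := code 1)
        ((hidx x).2 (hl x List.mem_cons_self)) j
      obtain ⟨j'', hj'', h''⟩ := ih (fun y hy => hl y (List.mem_cons_of_mem x hy)) (k + 1) (β * x)
        j' (hj'.trans (Nat.succ_le_succ (pair_le_pair le_rfl hj)))
        (h'.trans (by rw [← hop, ← h]))
      refine ⟨j'', ?_, ?_⟩
      · rwa [List.length_cons, Nat.add_comm l.length 1, ← Nat.add_assoc]
      · rw [h'', List.prod_cons, mul_assoc]
  refine ⟨fun p => decide (∃ k ≤ stepBound idx.length (G p.1), W k = p.2),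
    (computable_decide_exists_le hW).comp
      ((computable_stepBound _).comp (hG.comp Computable.fst)) Computable.snd, ?_⟩
  intro r m hm
  rw [decide_eq_true_iff]
  constructor
  · rintro ⟨k, -, hk⟩
    obtain ⟨β, hβ⟩ := hsound k
    refine ⟨β, fun i => hinj ?_⟩
    exact congrFun (List.ofFn_injective (hk.symm.trans hβ)) i
  · rintro ⟨α, hα⟩
    obtain ⟨l, hl, hlX, rfl⟩ := exists_list_prod_eq hXc α
    obtain ⟨j, hj, h⟩ := hcomplete l hlX 0 1 0 le_rfl (by simp only [W, iterOps_zero])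
    refine ⟨j, hj.trans (stepBound_mono _ ?_), ?_⟩
    · rw [Nat.zero_add, hl]
      refine (hbound _).trans (hGF m _ fun i => ?_)
      rw [← hα]
      exact (elemLength_realize_le a (r i)).trans (hm i)
    · rw [h, one_mul]
      simp only [code, ← hα]

end FinPres

namespace FinPres

open Encodable FirstOrder.Language

variable {L : FirstOrder.Language.{u, v}} {n N : ℕ} {A B C : Type w}
  [L.Structure A] [L.Structure B] [L.Structure C]

/-! ### Finitely presented quasi-Hopfian structures -/

theorem isQF_subst {α β : Type*} {φ : L.Formula α} (hφ : φ.IsQF) (f : α → L.Term β) :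
    (BoundedFormula.subst φ f).IsQF := by
  induction hφ with
  | falsum => exact .falsum
  | of_isAtomic h => cases h with
    | equal t s => exact (BoundedFormula.IsAtomic.equal _ _).isQF
    | rel R ts => exact (BoundedFormula.IsAtomic.rel _ _).isQF
  | imp _ _ h₁ h₂ => exact h₁.imp h₂

theorem realize_formula_subst {α β : Type*} {φ : L.Formula α} {f : α → L.Term β} {v : β → B} :
    Formula.Realize (BoundedFormula.subst φ f) v ↔ φ.Realize fun i => (f i).realize v :=
  BoundedFormula.realize_subst

theorem isQF_equal {α : Type*} (t s : L.Term α) : (t.equal s).IsQF :=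
  (BoundedFormula.IsAtomic.equal _ _).isQF

theorem isQF_rel {α : Type*} {l : ℕ} (R : L.Relations l) (ts : Fin l → L.Term α) :
    (R.formula ts).IsQF :=
  (BoundedFormula.IsAtomic.rel _ _).isQF

theorem exists_isQF_realize_iff {α : Type*} {T : Set (L.Formula α)} (hT : T.Finite)
    (hqf : ∀ φ ∈ T, φ.IsQF) :
    ∃ κ : L.Formula α, κ.IsQF ∧ ∀ v : α → B, κ.Realize v ↔ ∀ φ ∈ T, φ.Realize v := by
  induction T, hT using Set.Finite.induction_on with
  | empty => exact ⟨⊤, BoundedFormula.IsQF.top, by simp⟩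
  | @insert φ T _ _ ih =>
    obtain ⟨κ, hκ, h⟩ := ih fun ψ hψ => hqf ψ (Set.mem_insert_of_mem _ hψ)
    exact ⟨φ ⊓ κ, (hqf φ (Set.mem_insert _ _)).inf hκ, fun v => by
      simp [Formula.realize_inf, h]⟩

theorem realize_hom_apply (f : B →[L] C) {α : Type*} (t : L.Term α) (b : α → B) :
    f (t.realize b) = t.realize fun i => f (b i) :=
  (HomClass.realize_term f).symm

theorem surjective_of_forall_mem_range {a : Fin n → A}
    (ha : Substructure.closure L (Set.range a) = ⊤) (f : B →[L] A)
    (h : ∀ i, ∃ y, f y = a i) : Function.Surjective f := by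
  intro x
  obtain ⟨t, rfl⟩ := exists_term_realize_eq ha x
  choose y hy using h
  exact ⟨t.realize y, by rw [realize_hom_apply]; simp only [hy]⟩

/-- In a finitely presented quasi-Hopfian structure generated by `a`, some quantifier-free formula
true of `a` is true only of images of `a` under endomorphisms that are automorphisms whenever they
are surjective. -/
theorem exists_isQF_forall_realize {K : Set (CategoryTheory.Bundled.{w} L.Structure)}
    (hfp : FinitelyPresented L K A) (hqh : QuasiHopfian L A) {a : Fin n → A}
    (ha : Substructure.closure L (Set.range a) = ⊤) :
    ∃ κ : L.Formula (Fin n), κ.IsQF ∧ κ.Realize a ∧ ∀ c : Fin n → A, κ.Realize c →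
      ∃ g : A →[L] A, (∀ i, g (a i) = c i) ∧
        (Function.Surjective g → ∃ e : A ≃[L] A, e.toHom = g) := by
  obtain ⟨hK, m, p, Φ, hp, hΦ, hat, hpres⟩ := hfp
  obtain ⟨S, hS, -, hSaut⟩ := hqh
  choose T hT using exists_term_realize_eq (L := L) ha
  choose P hP using exists_term_realize_eq (L := L) hp
  let T₁ : Set (L.Formula (Fin n)) := (fun φ => BoundedFormula.subst φ fun i => T (p i)) '' Φ
  let T₂ : Set (L.Formula (Fin n)) :=
    Set.range fun i => (Term.var i).equal ((P (a i)).subst fun j => T (p j))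
  let T₃ : Set (L.Formula (Fin n)) :=
    (fun q : A × A => ((T q.1).equal (T q.2)).not) '' {q ∈ S ×ˢ S | q.1 ≠ q.2}
  have hfin : (T₁ ∪ T₂ ∪ T₃).Finite :=
    ((hΦ.image _).union (Set.finite_range _)).union
      (((hS.prod hS).subset (Set.sep_subset _ _)).image _)
  obtain ⟨κ, hκ, h⟩ := exists_isQF_realize_iff (B := A) hfin (by
    rintro _ ((⟨φ, hφ, rfl⟩ | ⟨i, rfl⟩) | ⟨q, -, rfl⟩)
    · exact isQF_subst (hat φ hφ).1.isQF _
    · exact isQF_equal _ _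
    · exact (isQF_equal _ _).not)
  refine ⟨κ, hκ, (h a).2 ?_, fun c hc => ?_⟩
  · rintro _ ((⟨φ, hφ, rfl⟩ | ⟨i, rfl⟩) | ⟨q, ⟨-, hq⟩, rfl⟩)
    · rw [realize_formula_subst]
      simpa only [hT] using (hat φ hφ).2
    · simp [Formula.realize_equal, Term.realize_subst, hT, hP]
    · simpa [Formula.realize_equal, hT] using hq
  · rw [h] at hc
    obtain ⟨g, hg⟩ := hpres ⟨A, inferInstance⟩ hK (fun i => (T (p i)).realize c) fun φ hφ =>
      realize_formula_subst.1 (hc _ (.inl (.inl ⟨φ, hφ, rfl⟩)))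
    have hga : ∀ i, g (a i) = c i := by
      intro i
      have h2 := hc _ (.inl (.inr ⟨i, rfl⟩))
      rw [Formula.realize_equal, Term.realize_subst] at h2
      rw [← hP (a i), realize_hom_apply]
      simp only [hg]
      exact h2.symm
    refine ⟨g, hga, fun hsurj => hSaut g hsurj fun x hx y hy hxy => ?_⟩
    by_contra hne
    have h3 := hc _ (.inr ⟨(x, y), ⟨⟨hx, hy⟩, hne⟩, rfl⟩)
    rw [Formula.realize_not, Formula.realize_equal] at h3
    apply h3
    rw [← hT x, ← hT y, realize_hom_apply, realize_hom_apply] at hxy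
    simpa only [hga] using hxy

/-- The condition on a tuple `b` expressed by the `Π₁` formula defining the orbit of `a`: its
quantifier-free type is that of `a`, and it is not of the form `r(z)` with `z` satisfying `κ`
for terms `r` such that `r(a)` is outside the orbit of `a`. -/
structure OrbitCond (κ : L.Formula (Fin n)) (a : Fin n → A) (b : Fin n → B) : Prop where
  orbit : ∀ r : Fin n → L.Term (Fin n), (fun i => (r i).realize a) ∉ autOrbit L a →
    ∀ z : Fin n → B, (∀ i, b i = (r i).realize z) → ¬ κ.Realize z
  eq : ∀ t s : L.Term (Fin n), t.realize b = s.realize b ↔ t.realize a = s.realize a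
  rel : ∀ (l : ℕ) (R : L.Relations l) (ts : Fin l → L.Term (Fin n)),
    Structure.RelMap R (fun i => (ts i).realize b) ↔ Structure.RelMap R fun i => (ts i).realize a

namespace OrbitCond

variable {κ : L.Formula (Fin n)} {a : Fin n → A} {b : Fin n → B}

theorem map_equiv (h : OrbitCond κ a b) (e : B ≃[L] C) :
    OrbitCond κ a fun i => e (b i) := by
  have hr : ∀ t : L.Term (Fin n), t.realize (fun i => e (b i)) = e (t.realize b) :=
    fun t => HomClass.realize_term e
  refine ⟨fun r hr z hz hκ => h.orbit r hr (fun i => e.symm (z i)) (fun i => ?_) ?_,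
    fun t s => ?_, fun l R ts => ?_⟩
  · rw [← e.symm_apply_apply (b i), hz i]
    exact (HomClass.realize_term e.symm).symm
  · exact (StrongHomClass.realize_formula e.symm κ).2 hκ
  · rw [hr, hr, e.injective.eq_iff, h.eq]
  · simp only [hr]
    rw [← h.rel, ← StrongHomClass.map_rel e]
    rfl

theorem nonempty_equiv (h : OrbitCond κ a b)
    (ha : Substructure.closure L (Set.range a) = ⊤)
    (hb : ∀ y, ∃ t : L.Term (Fin n), t.realize b = y) : Nonempty (A ≃[L] B) := by
  choose T hT using exists_term_realize_eq (L := L) ha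
  have key : ∀ t : L.Term (Fin n), (T (t.realize a)).realize b = t.realize b :=
    fun t => (h.eq _ _).2 (hT _)
  choose U hU using hb
  refine ⟨⟨⟨fun x => (T x).realize b, fun y => (U y).realize a, fun x => ?_, fun y => ?_⟩, ?_, ?_⟩⟩
  · rw [← hT x, ← h.eq]
    simp only [hU, hT]
  · simp only [key, hU]
  · intro l f x
    change (T _).realize b = Structure.funMap f fun i => (T (x i)).realize b
    rw [← Term.realize_func, h.eq, Term.realize_func, hT]
    simp only [hT]
  · intro l R x
    change Structure.RelMap R (fun i => (T (x i)).realize b) ↔ _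
    rw [h.rel]
    simp only [hT]

end OrbitCond

theorem orbitCond_iff_mem_autOrbit {κ : L.Formula (Fin n)} {a : Fin n → A}
    (ha : Substructure.closure L (Set.range a) = ⊤) (hκa : κ.Realize a)
    (hκ : ∀ c : Fin n → A, κ.Realize c → ∃ g : A →[L] A, (∀ i, g (a i) = c i) ∧
      (Function.Surjective g → ∃ e : A ≃[L] A, e.toHom = g)) (b : Fin n → A) :
    OrbitCond κ a b ↔ b ∈ autOrbit L a := by
  constructor
  · intro h
    choose r hr using fun i => exists_term_realize_eq (L := L) ha (b i)
    by_contra hb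
    exact h.orbit r (by simpa only [hr] using hb) a (fun i => (hr i).symm) hκa
  · rintro ⟨α, hα⟩
    have haa : OrbitCond κ a a := by
      refine ⟨fun r hr z hz hκz => hr ?_, fun _ _ => Iff.rfl, fun _ _ _ => Iff.rfl⟩
      obtain ⟨g, hg, hge⟩ := hκ z hκz
      have hgr : ∀ i, g ((r i).realize a) = a i := fun i => by
        rw [hz i, realize_hom_apply]
        simp only [hg]
      obtain ⟨e, rfl⟩ := hge (surjective_of_forall_mem_range ha g fun i => ⟨_, hgr i⟩)
      refine ⟨e.symm, fun i => ?_⟩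
      rw [← hgr i]
      exact (e.symm_apply_apply _).symm
    rw [show b = fun i => α (a i) from funext hα]
    exact haa.map_equiv α

/-! ### The formulas -/

open Classical in
/-- The formula `φ` or its negation, according to the truth of `p`. -/
noncomputable def literal {α : Type*} (p : Prop) (φ : L.Formula α) : L.Formula α :=
  if p then φ else φ.not

theorem realize_literal {α : Type*} {p : Prop} {φ : L.Formula α} {v : α → B} :
    (literal p φ).Realize v ↔ (φ.Realize v ↔ p) := by
  unfold literal
  split_ifs with h <;> simp [h, Formula.realize_not]

theorem isQF_literal {α : Type*} {p : Prop} {φ : L.Formula α} (h : φ.IsQF) :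
    (literal p φ).IsQF := by
  unfold literal
  split_ifs
  exacts [h, h.not]

/-- The conjunct of the quantifier-free type of `a` that decides the equality of two terms. -/
noncomputable def eqMatrix (a : Fin n → A) (X : Fin n → Fin N) (s : List (L.Term (Fin n))) :
    L.Formula (Fin N) :=
  if h : 2 ≤ s.length then
    literal (s[0].realize a = s[1].realize a) ((s[0].relabel X).equal (s[1].relabel X))
  else ⊤

/-- The conjunct of the quantifier-free type of `a` that decides a relation between terms. -/
noncomputable def relMatrix (a : Fin n → A) (X : Fin n → Fin N) (R : Σ l, L.Relations l)
    (s : List (L.Term (Fin n))) : L.Formula (Fin N) :=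
  if h : R.1 ≤ s.length then
    literal (Structure.RelMap R.2 fun i => s[i.1].realize a)
      (R.2.formula fun i => s[i.1].relabel X)
  else ⊤

/-- The formula `φ₁ → φ₂ → ⋯ → ψ`. -/
def impChain {α : Type*} (l : List (L.Formula α)) (ψ : L.Formula α) : L.Formula α :=
  l.foldr BoundedFormula.imp ψ

theorem realize_impChain {α : Type*} {l : List (L.Formula α)} {ψ : L.Formula α} {v : α → B} :
    (impChain l ψ).Realize v ↔ ((∀ φ ∈ l, φ.Realize v) → ψ.Realize v) := by
  induction l with
  | nil => simp [impChain]
  | cons φ l ih =>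
    have : (impChain (φ :: l) ψ).Realize v ↔ (φ.Realize v → (impChain l ψ).Realize v) :=
      Formula.realize_imp
    rw [this, ih]
    simp

theorem isQF_impChain {α : Type*} {l : List (L.Formula α)} {ψ : L.Formula α}
    (hl : ∀ φ ∈ l, φ.IsQF) (hψ : ψ.IsQF) : (impChain l ψ).IsQF := by
  induction l with
  | nil => exact hψ
  | cons φ l ih =>
    exact (hl φ List.mem_cons_self).imp (ih fun φ h => hl φ (List.mem_cons_of_mem _ h))

open Classical in
/-- The matrix of the statement that the variables `X` are not the values of the terms `s` at a
tuple `Z` satisfying `κ`, for terms whose values at `a` are outside the orbit of `a`. -/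
noncomputable def orbitMatrix (κ : L.Formula (Fin n)) (a : Fin n → A) (X Z : Fin n → Fin N)
    (s : List (L.Term (Fin n))) : L.Formula (Fin N) :=
  if h : s.length = n then
    if (fun i : Fin n => s[i.1].realize a) ∈ autOrbit L a then ⊤
    else impChain (List.ofFn fun i : Fin n => (Term.var (X i)).equal (s[i.1].relabel Z))
      (BoundedFormula.not (BoundedFormula.subst κ fun i => Term.var (Z i)))
  else ⊤

variable (L) in
/-- A list of all relation symbols. -/
noncomputable def relationSymbols [Finite (Σ l, L.Relations l)] : List (Σ l, L.Relations l) :=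
  (Set.toFinite (Set.univ : Set (Σ l, L.Relations l))).toFinset.toList

section

variable [Finite (Σ l, L.Functions l)] [Finite (Σ l, L.Relations l)]

/-- The kinds of conjuncts of the formula defining the orbit of `a`. -/
noncomputable def orbitMatrices (κ : L.Formula (Fin n)) (a : Fin n → A) (X Z : Fin n → Fin N) :
    List (List (L.Term (Fin n)) → L.Formula (Fin N)) :=
  orbitMatrix κ a X Z :: eqMatrix a X :: (relationSymbols L).map (relMatrix a X)

/-- The matrices of the conjuncts of the formula defining the orbit of `a`. -/
noncomputable def orbitConjunct (κ : L.Formula (Fin n)) (a : Fin n → A) (X Z : Fin n → Fin N)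
    (i : ℕ) : L.Formula (Fin N) :=
  (orbitMatrices κ a X Z).getD i.unpair.1 (fun _ => ⊤) (termStacks L n i.unpair.2)

variable {κ : L.Formula (Fin n)} {a : Fin n → A} {X Z : Fin n → Fin N}

theorem isQF_orbitConjunct (hκ : κ.IsQF) (i : ℕ) : (orbitConjunct κ a X Z i).IsQF := by
  have h : ∀ M ∈ orbitMatrices κ a X Z, ∀ s, (M s).IsQF := by
    intro M hM s
    rcases List.mem_cons.1 hM with rfl | hM
    · unfold orbitMatrix
      split_ifs
      · exact BoundedFormula.IsQF.top
      · refine isQF_impChain (fun φ hφ => ?_) (isQF_subst hκ _).not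
        obtain ⟨i, rfl⟩ := (List.mem_ofFn' _ _).1 hφ
        exact isQF_equal _ _
      · exact BoundedFormula.IsQF.top
    rcases List.mem_cons.1 hM with rfl | hM
    · unfold eqMatrix
      split_ifs
      exacts [isQF_literal (isQF_equal _ _), BoundedFormula.IsQF.top]
    · obtain ⟨R, -, rfl⟩ := List.mem_map.1 hM
      unfold relMatrix
      split_ifs
      exacts [isQF_literal (isQF_rel _ _), BoundedFormula.IsQF.top]
  rcases lt_or_ge i.unpair.1 (orbitMatrices κ a X Z).length with hk | hk
  · rw [orbitConjunct, List.getD_eq_getElem _ _ hk]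
    exact h _ (List.getElem_mem hk) _
  · rw [orbitConjunct, List.getD_eq_default _ _ hk]
    exact BoundedFormula.IsQF.top

theorem forall_realize_orbitConjunct {v : Fin N → B} :
    (∀ i, (orbitConjunct κ a X Z i).Realize v) ↔
      ∀ M ∈ orbitMatrices κ a X Z, ∀ s, (M s).Realize v := by
  constructor
  · intro h M hM s
    obtain ⟨k, hk, rfl⟩ := List.getElem_of_mem hM
    obtain ⟨j, rfl⟩ := exists_termStacks_eq s
    have := h (Nat.pair k j)
    rwa [orbitConjunct, Nat.unpair_pair, List.getD_eq_getElem _ _ hk] at this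
  · intro h i
    rcases lt_or_ge i.unpair.1 (orbitMatrices κ a X Z).length with hk | hk
    · rw [orbitConjunct, List.getD_eq_getElem _ _ hk]
      exact h _ (List.getElem_mem hk) _
    · rw [orbitConjunct, List.getD_eq_default _ _ hk]
      exact Formula.realize_top.2 trivial

theorem orbitCond_iff_forall_realize {b : Fin n → B} (v : (Fin n → B) → Fin N → B)
    (hX : ∀ z i, v z (X i) = b i) (hZ : ∀ z i, v z (Z i) = z i) :
    OrbitCond κ a b ↔ ∀ i z, (orbitConjunct κ a X Z i).Realize (v z) := by
  rw [forall_comm]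
  simp only [forall_realize_orbitConjunct, orbitMatrices, List.forall_mem_cons, List.forall_mem_map]
  have hXt : ∀ z (t : L.Term (Fin n)), (t.relabel X).realize (v z) = t.realize b := by
    intro z t
    rw [Term.realize_relabel]
    exact congrArg t.realize (funext (hX z))
  have hZt : ∀ z (t : L.Term (Fin n)), (t.relabel Z).realize (v z) = t.realize z := by
    intro z t
    rw [Term.realize_relabel]
    exact congrArg t.realize (funext (hZ z))
  have hkey : ∀ z, (∀ s, (orbitMatrix κ a X Z s).Realize (v z)) ↔
      ∀ r : Fin n → L.Term (Fin n), (fun i => (r i).realize a) ∉ autOrbit L a →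
        (∀ i, b i = (r i).realize z) → ¬ κ.Realize z := by
    intro z
    have hnot : (Formula.Realize (BoundedFormula.not
        (BoundedFormula.subst κ fun i => Term.var (Z i))) (v z)) ↔ ¬ κ.Realize z := by
      refine Formula.realize_not.trans (not_congr (realize_formula_subst.trans ?_))
      simp only [Term.realize_var, hZ]
    constructor
    · intro h r hr hb
      have h' := h (List.ofFn r)
      simp only [orbitMatrix, List.length_ofFn, dite_true, List.getElem_ofFn, Fin.eta, hr,
        if_false] at h'
      rw [realize_impChain, hnot] at h'
      refine h' fun φ hφ => ?_
      obtain ⟨i, rfl⟩ := (List.mem_ofFn' _ _).1 hφ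
      rw [Formula.realize_equal, Term.realize_var, hX, hZt, hb]
    · intro h s
      unfold orbitMatrix
      split_ifs with hs ho
      · exact Formula.realize_top.2 trivial
      · rw [realize_impChain, hnot]
        intro hφ
        refine h (fun i => s[i.1]) ho fun i => ?_
        have := hφ _ ((List.mem_ofFn' _ _).2 ⟨i, rfl⟩)
        rwa [Formula.realize_equal, Term.realize_var, hX, hZt] at this
      · exact Formula.realize_top.2 trivial
  constructor
  · intro h z
    refine ⟨(hkey z).2 fun r hr => h.orbit r hr z, fun s => ?_, fun R _ s => ?_⟩
    · unfold eqMatrix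
      split_ifs
      · rw [realize_literal, Formula.realize_equal, hXt, hXt, h.eq]
      · exact Formula.realize_top.2 trivial
    · unfold relMatrix
      split_ifs
      · rw [realize_literal, Formula.realize_rel]
        simp only [hXt]
        exact h.rel _ _ _
      · exact Formula.realize_top.2 trivial
  · intro h
    refine ⟨fun r hr z => (hkey z).1 (h z).1 r hr, fun t s => ?_, fun l R ts => ?_⟩
    · have := (h b).2.1 [t, s]
      rw [eqMatrix, dif_pos (by simp), realize_literal, Formula.realize_equal, hXt, hXt] at this
      exact this
    · have := (h b).2.2 ⟨l, R⟩ (by simp [relationSymbols]) (List.ofFn ts)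
      rw [relMatrix, dif_pos (by simp), realize_literal, Formula.realize_rel] at this
      simpa [hXt] using this

/-- The `Π₁` formula defining the orbit of `a`. -/
noncomputable def orbitFormula (κ : L.Formula (Fin n)) (a : Fin n → A) (X : Fin n → Fin N) :
    InfFormula L N :=
  .iInf fun i => .all n (.ofFormula
    (orbitConjunct κ a (fun i => Fin.castAdd n (X i)) (fun i => Fin.natAdd N i) i))

theorem realize_orbitFormula {v : Fin N → B} :
    (orbitFormula κ a X).Realize v ↔ OrbitCond κ a fun i => v (X i) := by
  rw [orbitCond_iff_forall_realize (fun z => Fin.append v z) (fun z i => Fin.append_left _ _ _)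
    fun z i => Fin.append_right _ _ _]
  rfl

/-- The disjuncts of the statement that `X` does not satisfy the formula defining the orbit of `a`
or generates `y`. -/
noncomputable def generationDisjunct (κ : L.Formula (Fin n)) (a : Fin n → A)
    (X Z : Fin n → Fin N) (y : Fin N) (i : ℕ) : L.Formula (Fin N) :=
  if i.unpair.1 = 0 then (orbitConjunct κ a X Z i.unpair.2).not
  else if h : 1 ≤ (termStacks L n i.unpair.2).length then
    (Term.var y).equal ((termStacks L n i.unpair.2)[0].relabel X)
  else ⊥

theorem isQF_generationDisjunct {y : Fin N} (hκ : κ.IsQF) (i : ℕ) :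
    (generationDisjunct κ a X Z y i).IsQF := by
  unfold generationDisjunct
  split_ifs
  exacts [(isQF_orbitConjunct hκ _).not, isQF_equal _ _, .falsum]

theorem exists_realize_generationDisjunct {y : Fin N} {b : Fin n → B} {x : B}
    (v : (Fin n → B) → Fin N → B) (hX : ∀ z i, v z (X i) = b i) (hZ : ∀ z i, v z (Z i) = z i)
    (hy : ∀ z, v z y = x) :
    (∃ i z, (generationDisjunct κ a X Z y i).Realize (v z)) ↔
      (OrbitCond κ a b → ∃ t : L.Term (Fin n), t.realize b = x) := by
  have hXt : ∀ z (t : L.Term (Fin n)), (t.relabel X).realize (v z) = t.realize b := by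
    intro z t
    rw [Term.realize_relabel]
    exact congrArg t.realize (funext (hX z))
  constructor
  · rintro ⟨i, z, h⟩ hb
    unfold generationDisjunct at h
    split_ifs at h with hi hl
    · exact absurd ((orbitCond_iff_forall_realize v hX hZ).1 hb i.unpair.2 z)
        (Formula.realize_not.1 h)
    · rw [Formula.realize_equal, hXt, Term.realize_var, hy] at h
      exact ⟨_, h.symm⟩
    · exact (Formula.realize_bot.1 h).elim
  · intro h
    by_cases hb : OrbitCond κ a b
    · obtain ⟨t, ht⟩ := h hb
      obtain ⟨j, hj⟩ := exists_termStacks_eq [t]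
      refine ⟨Nat.pair 1 j, b, ?_⟩
      unfold generationDisjunct
      simp only [Nat.unpair_pair, one_ne_zero, if_false, hj, List.length_singleton, le_refl,
        dite_true, List.getElem_cons_zero]
      rw [Formula.realize_equal, hXt, Term.realize_var, hy, ht]
    · rw [orbitCond_iff_forall_realize v hX hZ] at hb
      push Not at hb
      obtain ⟨i, z, hiz⟩ := hb
      refine ⟨Nat.pair 0 i, z, ?_⟩
      unfold generationDisjunct
      simp only [Nat.unpair_pair, if_true]
      exact Formula.realize_not.2 hiz

/-- The `Σ₁` formula stating that `X` does not satisfy the formula defining the orbit of `a` or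
generates `y`. -/
noncomputable def generationFormula (κ : L.Formula (Fin n)) (a : Fin n → A) (X : Fin n → Fin N)
    (y : Fin N) : InfFormula L N :=
  .iSup fun i => .ex n (.ofFormula
    (generationDisjunct κ a (fun i => Fin.castAdd n (X i)) (fun i => Fin.natAdd N i)
      (Fin.castAdd n y) i))

theorem realize_generationFormula {v : Fin N → B} {y : Fin N} :
    (generationFormula κ a X y).Realize v ↔
      (OrbitCond κ a (fun i => v (X i)) →
        ∃ t : L.Term (Fin n), t.realize (fun i => v (X i)) = v y) := by
  rw [← exists_realize_generationDisjunct (fun z => Fin.append v z)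
    (fun z i => Fin.append_left _ _ _) (fun z i => Fin.append_right _ _ _)
    fun z => Fin.append_left v z y]
  rfl

/-- The first conjunct of the Scott sentence: some tuple satisfies the formula defining the
orbit of `a`. -/
noncomputable def scottSigma (κ : L.Formula (Fin n)) (a : Fin n → A) : InfFormula L 0 :=
  .iSup fun _ => .ex n (orbitFormula κ a (Fin.natAdd 0))

/-- The second conjunct of the Scott sentence: every tuple satisfying the formula defining the
orbit of `a` generates the structure. -/
noncomputable def scottPi (κ : L.Formula (Fin n)) (a : Fin n → A) : InfFormula L 0 :=
  .iInf fun _ => .all (n + 1)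
    (generationFormula κ a (fun i => Fin.natAdd 0 i.castSucc) (Fin.natAdd 0 (Fin.last n)))

theorem realize_scottSigma : (scottSigma κ a).Realize (Fin.elim0 : Fin 0 → B) ↔
    ∃ b : Fin n → B, OrbitCond κ a b := by
  have h : ∀ b : Fin n → B, (orbitFormula κ a (Fin.natAdd 0)).Realize (Fin.append Fin.elim0 b) ↔
      OrbitCond κ a b := fun b => by
    rw [realize_orbitFormula]
    simp only [Fin.append_right]
  simp only [← h]
  exact ⟨fun ⟨_, h⟩ => h, fun h => ⟨0, h⟩⟩

theorem realize_scottPi : (scottPi κ a).Realize (Fin.elim0 : Fin 0 → B) ↔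
    ∀ b : Fin n → B, OrbitCond κ a b → ∀ x, ∃ t : L.Term (Fin n), t.realize b = x := by
  have h : ∀ b : Fin (n + 1) → B, (generationFormula κ a (fun i => Fin.natAdd 0 i.castSucc)
      (Fin.natAdd 0 (Fin.last n))).Realize (Fin.append Fin.elim0 b) ↔
      (OrbitCond κ a (fun i => b i.castSucc) →
        ∃ t : L.Term (Fin n), t.realize (fun i => b i.castSucc) = b (Fin.last n)) := fun b => by
    rw [realize_generationFormula]
    simp only [Fin.append_right]
  constructor
  · intro hπ b hb x
    have := (h (Fin.snoc b x)).1 (hπ 0 _)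
    simp only [Fin.snoc_castSucc, Fin.snoc_last] at this
    exact this hb
  · intro hb _ y
    exact (h y).2 fun hy => hb _ hy _

theorem isScottSentence_and (ha : Substructure.closure L (Set.range a) = ⊤)
    (hκ : ∀ b : Fin n → A, OrbitCond κ a b ↔ b ∈ autOrbit L a) :
    (InfFormula.and (scottSigma κ a) (scottPi κ a)).IsScottSentence A := by
  intro B _ _
  have : (InfFormula.and (scottSigma κ a) (scottPi κ a)).Realize (Fin.elim0 : Fin 0 → B) ↔
    (scottSigma κ a).Realize (Fin.elim0 : Fin 0 → B) ∧
      (scottPi κ a).Realize (Fin.elim0 : Fin 0 → B) := Iff.rfl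
  rw [this, realize_scottSigma, realize_scottPi]
  constructor
  · rintro ⟨⟨b, hb⟩, h⟩
    exact hb.nonempty_equiv ha (h b hb)
  · rintro ⟨e⟩
    refine ⟨⟨_, ((hκ a).2 ⟨.refl L A, fun i => rfl⟩).map_equiv e⟩, fun b hb x => ?_⟩
    obtain ⟨α, hα⟩ := (hκ _).1 (hb.map_equiv e.symm)
    obtain ⟨t, ht⟩ := exists_term_realize_eq (L := L) ha (α.symm (e.symm x))
    refine ⟨t, (e.comp α).symm.injective ?_⟩
    have hb' : ∀ i, (e.comp α).symm (b i) = a i := fun i => by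
      change α.symm (e.symm (b i)) = _
      exact (congrArg α.symm (hα i)).trans (α.symm_apply_apply _)
    refine (HomClass.realize_term (e.comp α).symm).symm.trans ?_
    rw [show ((e.comp α).symm ∘ b) = a from funext hb']
    exact ht

theorem isPi_orbitFormula (hκ : κ.IsQF) : (orbitFormula κ a X).IsPi 1 :=
  .conj _ (fun _ => 0) _ (fun _ => one_pos) fun i => .zero (isQF_orbitConjunct hκ i)

theorem isDSigma_scott (hκ : κ.IsQF) :
    (InfFormula.and (scottSigma κ a) (scottPi κ a)).IsDSigma 2 :=
  ⟨_, _, rfl, .disj _ (fun _ => 1) _ (fun _ => one_lt_two) fun _ => isPi_orbitFormula hκ,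
    .conj _ (fun _ => 1) _ (fun _ => one_lt_two) fun _ =>
      .disj _ (fun _ => 0) _ (fun _ => one_pos) fun i => .zero (isQF_generationDisjunct hκ i)⟩

end

end FinPres

namespace FinPres

open Encodable FirstOrder.Language

variable {L : FirstOrder.Language.{u, v}} {n N : ℕ} {A : Type w} [L.Structure A]

section

variable [Finite (Σ l, L.Functions l)]

theorem computable_getD_termStacks {γ : Type*} [Primcodable γ] {h : L.Term (Fin n) → γ}
    (hh : Computable fun j => (termStacks L n j).map h) (i : ℕ) (d : γ) :
    Computable fun j => ((termStacks L n j).map h).getD i d :=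
  ((Primrec.list_getD d).comp Primrec.id (Primrec.const i)).to_comp.comp hh

variable (L n) in
theorem computable_length_termStacks : Computable fun j => (termStacks L n j).length :=
  (Computable.list_length.comp
    (computable_map_listEncode (L := L) (n := n) fun _ => 0)).of_eq fun j => by simp

end

/-! ### Gödel numbers -/

theorem listEncode_relabel {α β : Type*} (g : α → β) (t : L.Term α) :
    (t.relabel g).listEncode = t.listEncode.map (Sum.map g id) := by
  induction t with
  | var i => rfl
  | func f ts ih => simp [Term.listEncode, ih, List.map_flatMap]

theorem encode_map_encode {α : Type*} [Encodable α] (l : List α) :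
    encode (l.map encode) = encode l := by
  induction l with
  | nil => rfl
  | cons x l ih => rw [List.map_cons, encode_list_cons, encode_list_cons, ih, encode_nat]

variable [Encodable (Σ l, L.Functions l)]

/-- The code of a symbol of a term after the substitution `X` of variables. -/
def termSymbolCode (X : Fin n → Fin N) (s : Fin n ⊕ Σ l, L.Functions l) : ℕ :=
  encode (Sum.map (fun i => (Sum.inl (X i) : Fin N ⊕ Fin 0)) id s)

/-- The code, as a symbol of a formula, of the term with the list `s` of symbol codes. -/
def termCode (s : List ℕ) : ℕ := 2 * Nat.pair 0 (encode s)

theorem computable_termCode : Computable termCode :=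
  Primrec.nat_double.to_comp.comp
    (Primrec₂.natPair.to_comp.comp (Computable.const 0) Computable.encode)

theorem computable_termCode_getD [Finite (Σ l, L.Functions l)] (X : Fin n → Fin N) (i : ℕ) :
    Computable fun j => termCode (((termStacks L n j).map fun t =>
      t.listEncode.map (termSymbolCode X)).getD i []) :=
  computable_termCode.comp (computable_getD_termStacks (computable_map_listEncode _) i _)

variable [Encodable (Σ l, L.Relations l)]

/-- The list of the codes of the symbols of a formula. -/
def symbolCodes (φ : L.Formula (Fin N)) : List ℕ :=
  (BoundedFormula.listEncode φ).map encode

theorem encode_symbolCodes (φ : L.Formula (Fin N)) :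
    encode (symbolCodes φ) = InfFormula.formulaCode φ :=
  encode_map_encode _

theorem encode_inl_relabel (X : Fin n → Fin N) (t : L.Term (Fin n)) :
    encode (Sum.inl ⟨0, (t.relabel X).relabel Sum.inl⟩ : (Σ k, L.Term (Fin N ⊕ Fin k)) ⊕
      ((Σ n, L.Relations n) ⊕ ℕ)) = termCode (t.listEncode.map (termSymbolCode X)) := by
  rw [encode_inl, encode_sigma_val, termCode]
  have : encode ((t.relabel X).relabel Sum.inl : L.Term (Fin N ⊕ Fin 0)) =
      encode ((t.relabel X).relabel Sum.inl : L.Term (Fin N ⊕ Fin 0)).listEncode := rfl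
  rw [this, ← encode_map_encode, listEncode_relabel, listEncode_relabel, List.map_map,
    List.map_map]
  congr 3
  refine List.map_congr_left fun s _ => ?_
  rcases s with i | f <;> rfl

theorem symbolCodes_equal (X Y : Fin n → Fin N) (t s : L.Term (Fin n)) :
    symbolCodes ((t.relabel X).equal (s.relabel Y)) =
      [termCode (t.listEncode.map (termSymbolCode X)),
        termCode (s.listEncode.map (termSymbolCode Y))] := by
  rw [← encode_inl_relabel X t, ← encode_inl_relabel Y s]
  rfl

theorem symbolCodes_rel (X : Fin n → Fin N) {l : ℕ} (R : L.Relations l)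
    (ts : Fin l → L.Term (Fin n)) :
    symbolCodes (R.formula fun i => (ts i).relabel X) =
      (2 * (2 * encode (⟨l, R⟩ : Σ l, L.Relations l)) + 1) :: 3 ::
        List.ofFn fun i => termCode ((ts i).listEncode.map (termSymbolCode X)) := by
  have h : symbolCodes (R.formula fun i => (ts i).relabel X) =
      (2 * (2 * encode (⟨l, R⟩ : Σ l, L.Relations l)) + 1) :: 3 ::
        ((List.finRange l).map fun i => (Sum.inl ⟨0, ((ts i).relabel X).relabel Sum.inl⟩ :
          (Σ k, L.Term (Fin N ⊕ Fin k)) ⊕ ((Σ n, L.Relations n) ⊕ ℕ))).map encode := rfl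
  rw [h, List.map_map, List.ofFn_eq_map]
  simp only [Function.comp_def, encode_inl_relabel]

theorem symbolCodes_imp (φ ψ : L.Formula (Fin N)) :
    symbolCodes (BoundedFormula.imp φ ψ) = 3 :: (symbolCodes φ ++ symbolCodes ψ) := by
  simp [symbolCodes, BoundedFormula.listEncode]

/-- The list of symbol codes of the negation of a formula with symbol codes `c`. -/
def negCodes (c : List ℕ) : List ℕ := 3 :: (c ++ [11])

theorem symbolCodes_not (φ : L.Formula (Fin N)) :
    symbolCodes (BoundedFormula.not φ) = negCodes (symbolCodes φ) :=
  symbolCodes_imp φ ⊥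

theorem computable_negCodes : Computable negCodes :=
  Computable.list_cons.comp (Computable.const 3)
    (Computable.list_append.comp Computable.id (Computable.const [11]))

theorem symbolCodes_literal (p : Prop) [Decidable p] (φ : L.Formula (Fin N)) :
    symbolCodes (literal p φ) = if p then symbolCodes φ else negCodes (symbolCodes φ) := by
  unfold literal
  split_ifs
  · rfl
  · exact symbolCodes_not φ

theorem symbolCodes_impChain (l : List (L.Formula (Fin N))) (ψ : L.Formula (Fin N)) :
    symbolCodes (impChain l ψ) = (l.map fun φ => 3 :: symbolCodes φ).flatten ++ symbolCodes ψ := by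
  induction l with
  | nil => rfl
  | cons φ l ih =>
    refine (symbolCodes_imp φ (impChain l ψ)).trans ?_
    rw [ih]
    simp

/-! ### Computability of the formulas -/

section

variable [Finite (Σ l, L.Functions l)]

/-- The relations of `A` are computable with respect to the numbering `ν`. -/
def ComputableRelations (L : FirstOrder.Language.{u, v}) {A : Type w} [L.Structure A]
    (ν : A → ℕ) : Prop :=
  ∀ (l : ℕ) (R : L.Relations l), ComputablePred fun s : List ℕ =>
    ∃ x : Fin l → A, s = List.ofFn (fun i => ν (x i)) ∧ Structure.RelMap R x

theorem map_take_eq_ofFn {α β : Type*} (f : α → β) (s : List α) (l : ℕ) (h : l ≤ s.length) :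
    (s.map f).take l = List.ofFn fun i : Fin l => f s[i.1] := by
  apply List.ext_getElem <;> simp [h]

variable {ν : A → ℕ} {a : Fin n → A}

theorem computable_symbolCodes_eqMatrix (hinj : Function.Injective ν)
    (hν : ComputableFunctions L ν) (X : Fin n → Fin N) :
    Computable fun j => symbolCodes (eqMatrix a X (termStacks L n j)) := by
  classical
  have hv := computable_map_realize hν a
  have hb : Computable fun j => [termCode (((termStacks L n j).map fun t =>
      t.listEncode.map (termSymbolCode X)).getD 0 []), termCode (((termStacks L n j).map fun t =>
      t.listEncode.map (termSymbolCode X)).getD 1 [])] :=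
    Computable.list_cons.comp (computable_termCode_getD X 0)
      (Computable.list_cons.comp (computable_termCode_getD X 1) (Computable.const []))
  refine (computable_ite
    (computable_decide_le (Computable.const 2) (computable_length_termStacks L n))
    (computable_ite (computable_decide_eq (computable_getD_termStacks hv 0 0)
      (computable_getD_termStacks hv 1 0)) hb (computable_negCodes.comp hb))
    (Computable.const (symbolCodes (⊤ : L.Formula (Fin N))))).of_eq fun j => ?_
  unfold eqMatrix
  split_ifs with h
  all_goals
    first
    | rfl
    | have h0 : 0 < (termStacks L n j).length := by omega
      have h1 : 1 < (termStacks L n j).length := by omega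
      simp_all [symbolCodes_literal, symbolCodes_equal, hinj.eq_iff]

theorem computable_symbolCodes_relMatrix (hinj : Function.Injective ν)
    (hν : ComputableFunctions L ν) (hR : ComputableRelations L ν) (X : Fin n → Fin N)
    (R : Σ l, L.Relations l) :
    Computable fun j => symbolCodes (relMatrix a X R (termStacks L n j)) := by
  classical
  obtain ⟨hd, hc⟩ := hR R.1 R.2
  have hv : Computable fun j => ((termStacks L n j).map fun t => ν (t.realize a)).take R.1 :=
    ((Primrec.list_take.comp (Primrec.const R.1) Primrec.id).to_comp).comp
      (computable_map_realize hν a)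
  have hb : Computable fun j => (2 * (2 * encode R) + 1) :: 3 :: List.ofFn fun i : Fin R.1 =>
      termCode (((termStacks L n j).map fun t =>
        t.listEncode.map (termSymbolCode X)).getD i []) :=
    Computable.list_cons.comp (Computable.const _) (Computable.list_cons.comp (Computable.const _)
      (Computable.list_ofFn fun i => computable_termCode_getD X i))
  refine (computable_ite
    (computable_decide_le (Computable.const R.1) (computable_length_termStacks L n))
    (computable_ite (hc.comp hv) hb (computable_negCodes.comp hb))
    (Computable.const (symbolCodes (⊤ : L.Formula (Fin N))))).of_eq fun j => ?_
  by_cases h : R.1 ≤ (termStacks L n j).length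
  · have hlt : ∀ i : Fin R.1, i.1 < (termStacks L n j).length := fun i => i.2.trans_le h
    have hrel : (∃ x : Fin R.1 → A, ((termStacks L n j).map fun t => ν (t.realize a)).take R.1 =
        List.ofFn (fun i => ν (x i)) ∧ Structure.RelMap R.2 x) ↔
        Structure.RelMap R.2 fun i : Fin R.1 =>
          ((termStacks L n j)[i.1]'(hlt i)).realize a := by
      rw [map_take_eq_ofFn _ _ _ h]
      constructor
      · rintro ⟨x, hx, hRx⟩
        convert hRx using 2 with i
        exact hinj (congrFun (List.ofFn_injective hx) i)
      · exact fun hRx => ⟨_, rfl, hRx⟩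
    rw [if_pos h, relMatrix, dif_pos h, symbolCodes_literal, symbolCodes_rel]
    simp only [hrel]
    simp [hlt]
  · rw [if_neg h, relMatrix, dif_neg h]

/-- Membership in the orbit of `a` is decidable for values of terms at `a`, given the numbers of
the values and a bound for the lengths of the terms. -/
def DecidableOrbit (ν : A → ℕ) (a : Fin n → A) : Prop :=
  ∃ D : ℕ × List ℕ → Bool, Computable D ∧
    ∀ (r : Fin n → L.Term (Fin n)) (m : ℕ), (∀ i, termLength (r i) ≤ m) →
      (D (m, List.ofFn fun i => ν ((r i).realize a)) = true ↔
        (fun i => (r i).realize a) ∈ autOrbit L a)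

theorem computable_symbolCodes_orbitMatrix (hν : ComputableFunctions L ν)
    (hO : DecidableOrbit (L := L) ν a) (κ : L.Formula (Fin n)) (X Z : Fin n → Fin N) :
    Computable fun j => symbolCodes (orbitMatrix κ a X Z (termStacks L n j)) := by
  classical
  obtain ⟨D, hD, hDO⟩ := hO
  have hm : Computable fun j =>
      ((termStacks L n j).map fun t => t.listEncode.map (termSymbolCode Z)).flatten.length :=
    Computable.list_length.comp (Primrec.list_flatten.to_comp.comp (computable_map_listEncode _))
  have hb : Computable fun j => (List.ofFn fun i : Fin n =>
      [3, termCode [termSymbolCode (L := L) X (Sum.inl i)],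
        termCode (((termStacks L n j).map fun t =>
          t.listEncode.map (termSymbolCode Z)).getD i [])]).flatten ++
      symbolCodes (BoundedFormula.not (BoundedFormula.subst κ fun i => Term.var (Z i))) :=
    Computable.list_append.comp (Primrec.list_flatten.to_comp.comp (Computable.list_ofFn fun i =>
      Computable.list_cons.comp (Computable.const _) (Computable.list_cons.comp (Computable.const _)
        (Computable.list_cons.comp (computable_termCode_getD Z i) (Computable.const [])))))
      (Computable.const _)
  refine (computable_ite
    (computable_decide_eq (computable_length_termStacks L n) (Computable.const n))
    (Computable.cond (hD.comp (hm.pair (computable_map_realize hν a)))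
      (Computable.const (symbolCodes (⊤ : L.Formula (Fin N)))) hb)
    (Computable.const (symbolCodes (⊤ : L.Formula (Fin N))))).of_eq fun j => ?_
  by_cases h : (termStacks L n j).length = n
  · have hlt : ∀ i : Fin n, i.1 < (termStacks L n j).length := fun i => i.2.trans_eq h.symm
    have hofFn := map_take_eq_ofFn (fun t => ν (t.realize a)) (termStacks L n j) n h.ge
    rw [List.take_of_length_le (by simp [h])] at hofFn
    have hiff := hDO (fun i : Fin n => (termStacks L n j)[i.1]'(hlt i))
      ((termStacks L n j).map fun t => t.listEncode.map (termSymbolCode Z)).flatten.length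
      (fun i => by
        refine le_trans (le_of_eq ?_) (List.Sublist.length_le (List.sublist_flatten_of_mem
          (List.mem_map_of_mem (List.getElem_mem (hlt i)))))
        rw [List.length_map, termLength])
    rw [← hofFn] at hiff
    rw [if_pos h, orbitMatrix, dif_pos h]
    by_cases ho : (fun i : Fin n => ((termStacks L n j)[i.1]'(hlt i)).realize a) ∈ autOrbit L a
    · rw [if_pos ho, hiff.2 ho, cond_true]
    · rw [if_neg ho, Bool.eq_false_iff.2 (mt hiff.1 ho), cond_false, symbolCodes_impChain]
      congr 2
      rw [List.map_ofFn]
      congr 1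
      funext i
      have := symbolCodes_equal X Z (Term.var i) ((termStacks L n j)[i.1]'(hlt i))
      rw [Term.relabel] at this
      simp [this, hlt, Term.listEncode]
  · rw [if_neg h, orbitMatrix, dif_neg h]

variable [Finite (Σ l, L.Relations l)]

theorem computable_symbolCodes_orbitConjunct (hinj : Function.Injective ν)
    (hν : ComputableFunctions L ν) (hR : ComputableRelations L ν)
    (hO : DecidableOrbit (L := L) ν a) (κ : L.Formula (Fin n)) (X Z : Fin n → Fin N) :
    Computable fun i => symbolCodes (orbitConjunct κ a X Z i) := by
  have h : ∀ f ∈ (orbitMatrices κ a X Z).map fun M j => symbolCodes (M (termStacks L n j)),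
      Computable f := by
    simp only [orbitMatrices, List.forall_mem_map, List.forall_mem_cons]
    exact ⟨computable_symbolCodes_orbitMatrix hν hO κ X Z,
      computable_symbolCodes_eqMatrix hinj hν X,
      fun R _ => computable_symbolCodes_relMatrix hinj hν hR X R⟩
  refine ((computable_getD_apply _ (fun _ => symbolCodes (⊤ : L.Formula (Fin N))) h
    (Computable.const _)).comp (Computable.fst.comp Computable.unpair)
    (Computable.snd.comp Computable.unpair)).of_eq fun i => ?_
  rw [orbitConjunct]
  rcases lt_or_ge i.unpair.1 (orbitMatrices κ a X Z).length with hk | hk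
  · rw [List.getD_eq_getElem _ _ hk, List.getD_eq_getElem _ _ (by simpa using hk), List.getElem_map]
  · rw [List.getD_eq_default _ _ hk, List.getD_eq_default _ _ (by simpa using hk)]

theorem computable_symbolCodes_generationDisjunct (hinj : Function.Injective ν)
    (hν : ComputableFunctions L ν) (hR : ComputableRelations L ν)
    (hO : DecidableOrbit (L := L) ν a) (κ : L.Formula (Fin n)) (X Z : Fin n → Fin N)
    (y : Fin N) :
    Computable fun i => symbolCodes (generationDisjunct κ a X Z y i) := by
  have hu : Computable fun i : ℕ => i.unpair.2 := Computable.snd.comp Computable.unpair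
  have hb : Computable fun j =>
      [termCode [termSymbolCode (L := L) (fun _ : Fin 1 => y) (Sum.inl 0)],
      termCode (((termStacks L n j).map fun t =>
        t.listEncode.map (termSymbolCode X)).getD 0 [])] :=
    Computable.list_cons.comp (Computable.const _)
      (Computable.list_cons.comp (computable_termCode_getD X 0) (Computable.const []))
  refine (computable_ite
    (computable_decide_eq (Computable.fst.comp Computable.unpair) (Computable.const 0))
    (computable_negCodes.comp
      ((computable_symbolCodes_orbitConjunct hinj hν hR hO κ X Z).comp hu))
    (computable_ite (computable_decide_le (Computable.const 1)
      ((computable_length_termStacks L n).comp hu)) (hb.comp hu)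
      (Computable.const (symbolCodes (⊥ : L.Formula (Fin N)))))).of_eq fun i => ?_
  unfold generationDisjunct
  split_ifs with h0 h1
  · exact (symbolCodes_not _).symm
  · have hlt : 0 < (termStacks L n i.unpair.2).length := h1
    rw [List.getD_eq_getElem _ _ (by simpa using hlt), List.getElem_map,
      ← encode_inl_relabel X]
    rfl
  · rfl

end

/-! ### Computable infinitary formulas -/

theorem exists_code_eval_eq {f : ℕ → ℕ} (hf : Computable f) :
    ∃ c : Nat.Partrec.Code, ∀ i, c.eval i = Part.some (f i) := by
  obtain ⟨c, hc⟩ := Nat.Partrec.Code.exists_code.1 (Partrec.nat_iff.1 hf.partrec)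
  exact ⟨c, fun i => by rw [hc]; rfl⟩

theorem exists_code_eval_eq_pair {m j e : ℕ → ℕ} (hm : Computable m) (hj : Computable j)
    (he : Computable e) :
    ∃ c : Nat.Partrec.Code, ∀ i, c.eval i = Part.some (Nat.pair (m i) (Nat.pair (j i) (e i))) :=
  exists_code_eval_eq (Primrec₂.natPair.to_comp.comp hm (Primrec₂.natPair.to_comp.comp hj he))

theorem isComputablePi_one (m : ℕ) {φ : ℕ → L.Formula (Fin (n + m))} (hφ : ∀ i, (φ i).IsQF)
    (hc : Computable fun i => symbolCodes (φ i)) :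
    (InfFormula.iInf fun i => .all m (.ofFormula (φ i))).IsComputablePi 1 := by
  have he : Computable fun i => InfFormula.formulaCode (φ i) :=
    (Computable.encode.comp hc).of_eq fun i => encode_symbolCodes _
  obtain ⟨c, h⟩ := exists_code_eval_eq_pair (Computable.const m) (Computable.const 0) he
  exact ⟨_, .conj _ _ _ _ c (fun _ => one_pos) (fun i => .zero (hφ i)) h⟩

theorem isComputableSigma_one (m : ℕ) {φ : ℕ → L.Formula (Fin (n + m))} (hφ : ∀ i, (φ i).IsQF)
    (hc : Computable fun i => symbolCodes (φ i)) :
    (InfFormula.iSup fun i => .ex m (.ofFormula (φ i))).IsComputableSigma 1 := by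
  have he : Computable fun i => InfFormula.formulaCode (φ i) :=
    (Computable.encode.comp hc).of_eq fun i => encode_symbolCodes _
  obtain ⟨c, h⟩ := exists_code_eval_eq_pair (Computable.const m) (Computable.const 0) he
  exact ⟨_, .disj _ _ _ _ c (fun _ => one_pos) (fun i => .zero (hφ i)) h⟩

theorem isComputablePi_succ {k m : ℕ} {ψ : InfFormula L (n + m)} (h : ψ.IsComputableSigma k) :
    (InfFormula.iInf fun _ => .all m ψ).IsComputablePi (k + 1) := by
  obtain ⟨e, he⟩ := h
  obtain ⟨c, hc⟩ := exists_code_eval_eq_pair (Computable.const m) (Computable.const k)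
    (Computable.const e)
  exact ⟨_, .conj _ _ _ _ c (fun _ => k.lt_succ_self) (fun _ => he) hc⟩

theorem isComputableSigma_succ {k m : ℕ} {ψ : InfFormula L (n + m)} (h : ψ.IsComputablePi k) :
    (InfFormula.iSup fun _ => .ex m ψ).IsComputableSigma (k + 1) := by
  obtain ⟨e, he⟩ := h
  obtain ⟨c, hc⟩ := exists_code_eval_eq_pair (Computable.const m) (Computable.const k)
    (Computable.const e)
  exact ⟨_, .disj _ _ _ _ c (fun _ => k.lt_succ_self) (fun _ => he) hc⟩

end FinPres

theorem theorem1p2 (L : FirstOrder.Language.{u, v})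
    [Finite (Σ l, L.Functions l)] [Finite (Σ l, L.Relations l)]
    [Encodable (Σ l, L.Functions l)] [Encodable (Σ l, L.Relations l)]
    (K : Set (CategoryTheory.Bundled.{w} L.Structure)) (A : Type w) [L.Structure A]
    (hfp : FinPres.FinitelyPresented L K A) (hqh : FinPres.QuasiHopfian L A)
    (n : ℕ) (a : Fin n → A) (ha : FirstOrder.Language.Substructure.closure L (Set.range a) = ⊤) :
    ((∃ θ : InfFormula L n, θ.IsPi 1 ∧ θ.Defines (FinPres.autOrbit L a)) ∧
      ∃ Θ : InfFormula L 0, Θ.IsDSigma 2 ∧ Θ.IsScottSentence A) ∧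
    (FinPres.ComputableStructure L A →
      (∃ (X : Set (A ≃[L] A)) (F : (Fin n → ℕ) → ℕ),
        X.Finite ∧ Subgroup.closure X = ⊤ ∧ Computable F ∧
        ∀ α : A ≃[L] A,
          FinPres.groupLength X α ≤ F fun i => FinPres.elemLength L a (α (a i))) →
      (∃ θ : InfFormula L n, θ.IsComputablePi 1 ∧ θ.Defines (FinPres.autOrbit L a)) ∧
        ∃ Θ : InfFormula L 0, Θ.IsComputableDSigma 2 ∧ Θ.IsScottSentence A) := by
  obtain ⟨κ, hκ, hκa, hκc⟩ := FinPres.exists_isQF_forall_realize hfp hqh ha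
  have horb := FinPres.orbitCond_iff_mem_autOrbit ha hκa hκc
  have hdef : (FinPres.orbitFormula κ a id).Defines (FinPres.autOrbit L a) := fun b =>
    FinPres.realize_orbitFormula.trans (horb b)
  have hscott := FinPres.isScottSentence_and ha horb
  refine ⟨⟨⟨_, FinPres.isPi_orbitFormula hκ, hdef⟩, _, FinPres.isDSigma_scott hκ, hscott⟩, ?_⟩
  rintro ⟨ν, hinj, -, hν, hR⟩ ⟨X, F, hX, hXc, hF, hbound⟩
  have hO : FinPres.DecidableOrbit (L := L) ν a :=
    FinPres.exists_computable_mem_autOrbit hinj hν ha hX hXc hF hbound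
  have hPi : ∀ {N : ℕ} (V : Fin n → Fin N), (FinPres.orbitFormula κ a V).IsComputablePi 1 :=
    fun V => FinPres.isComputablePi_one n (FinPres.isQF_orbitConjunct hκ)
      (FinPres.computable_symbolCodes_orbitConjunct hinj hν hR hO κ _ _)
  exact ⟨⟨_, hPi id, hdef⟩, _, ⟨_, _, rfl, FinPres.isComputableSigma_succ (hPi _),
    FinPres.isComputablePi_succ (FinPres.isComputableSigma_one n
      (FinPres.isQF_generationDisjunct hκ)
      (FinPres.computable_symbolCodes_generationDisjunct hinj hν hR hO κ _ _ _))⟩, hscott⟩
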